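/- Let $(R,\mathfrak m)$ be a one-dimensional Cohen–Macaulay (Noetherian) local ring, let $s\ge 1$, and let $I_1,\dots,I_s$ be $\mathfrak m$-primary ideals of $R$. For $\underline n\in\mathbb Z^s$ write $\underline I^{\underline n}=I_1^{n_1}\cdots I_s^{n_s}$, where $I_i^{k}=R$ for $k\le 0$; write $\underline n^+$ for the vector with entries $\max(n_i,0)$, put $e=(1,\dots,1)\in\mathbb Z^s$, and order $\mathbb Z^s$ componentwise. Let $\mathcal F=\{\mathcal F(\underline n)\}_{\underline n\in\mathbb Z^s}$ be an $\underline I$-admissible filtration of ideals of $R$. That is, for all $\underline m,\underline n\in\mathbb Z^s$: $\underline I^{\underline n}\subseteq\mathcal F(\underline n)$; $\mathcal F(\underline n)\mathcal F(\underline m)\subseteq\mathcal F(\underline n+\underline m)$; $\mathcal F(\underline m)\subseteq\mathcal F(\underline n)$ whenever $\underline m\ge\underline n$; $\mathcal F(\underline n)=\mathcal F(\underline n^+)$; and the extended Rees ring $\bigoplus_{\underline n\in\mathbb Z^s}\mathcal F(\underline n)\,t_1^{n_1}\cdots t_s^{n_s}$ is a finite module over $\bigoplus_{\underline n\in\mathbb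 Z^s}\underline I^{\underline n}\,t_1^{n_1}\cdots t_s^{n_s}$. A complete reduction of $\mathcal F$ is a family $\mathcal A=(a_1,\dots,a_s)$ with $a_i\in I_i$ for all $i$ such that the ideal $J=(a_1\cdots a_s)$ satisfies $J\mathcal F(\underline n)=\mathcal F(\underline n+e)$ for all $\underline n$ with all coordinates sufficiently large. A vector $\underline r\in\mathbb N^s$ is a reduction vector of $\mathcal F$ with respect to $\mathcal A$ if $J\mathcal F(\underline n)=\mathcal F(\underline n+e)$ for all $\underline n\ge\underline r$; let $\mathcal R_{\mathcal A}(\mathcal F)$ be the set of these vectors. The complete reduction number $r_{\mathcal A}(\mathcal F)$ is the least $k\in\mathbb N$ such that $J\mathcal F(\underline n)=\mathcal F(\underline n+e)$ for all $\underline n\ge ke$. Then $r_{\mathcal A}(\mathcal F)$ is the same for all complete reductions $\mathcal A$ of $\mathcal F$, and for every complete reduction $\mathcal A$ of $\mathcal F$ $$r_{\mathcal A}(\mathcal F)=\min\bigl\{\max\{t_1,\dots,t_s\} : (t_1,\dots,t_s)\in\mathcal R_{\mathcal A}(\mathcal F)\bigr\}.$$ -/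

import Mathlib

namespace MultiFil

universe u

variable {R : Type u} [CommRing R] {s : ℕ}

/-- The ideal `I^n = I_1^{n_1} ⋯ I_s^{n_s}` for `n ∈ ℤ^s`, with the convention that `I_i^k = R`
for `k ≤ 0`. -/
def idealPow (I : Fin s → Ideal R) (n : Fin s → ℤ) : Ideal R :=
  ∏ i, I i ^ (n i).toNat

/-- A `ℤ^s`-graded `I`-filtration `F` of ideals of `R`. -/
structure IsFiltration (I : Fin s → Ideal R) (F : (Fin s → ℤ) → Ideal R) : Prop where
  pow_le : ∀ n, idealPow I n ≤ F n
  mul_le : ∀ m n, F n * F m ≤ F (n + m)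
  anti : ∀ m n, n ≤ m → F m ≤ F n

theorem idealPow_mul_le (I : Fin s → Ideal R) (m n : Fin s → ℤ) :
    idealPow I m * idealPow I n ≤ idealPow I (m + n) := by
  unfold idealPow
  rw [← Finset.prod_mul_distrib]
  refine Finset.prod_le_prod' fun i _ => ?_
  rw [← pow_add]
  refine Ideal.pow_le_pow_right ?_
  simp only [Pi.add_apply]
  omega

theorem one_mem_idealPow_zero (I : Fin s → Ideal R) : (1 : R) ∈ idealPow I 0 := by
  simp only [idealPow, Pi.zero_apply, Int.toNat_zero, pow_zero, Finset.prod_const_one]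
  exact Submodule.mem_one.2 ⟨1, map_one _⟩

/-- In the Laurent polynomial ring `R[t_1^{±1}, …, t_s^{±1}]`, products of elements with
coefficients in `A n` and `B n` have coefficients in `C n`, as soon as `A m * B n ≤ C (m + n)`. -/
theorem coeff_mul_mem {A B C : (Fin s → ℤ) → Ideal R}
    (h : ∀ m n, A m * B n ≤ C (m + n)) (f g : AddMonoidAlgebra R (Fin s → ℤ))
    (hf : ∀ n, f.coeff n ∈ A n) (hg : ∀ n, g.coeff n ∈ B n) (n : Fin s → ℤ) :
    (f * g).coeff n ∈ C n := by
  classical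
  rw [AddMonoidAlgebra.coeff_mul]
  simp only [Finsupp.sum]
  refine Ideal.sum_mem _ fun a _ => Ideal.sum_mem _ fun b _ => ?_
  split_ifs with hab
  · rw [← hab]
    exact h a b (Ideal.mul_mem_mul (hf a) (hg b))
  · exact Ideal.zero_mem _

/-- The extended Rees ring `R'(I) = ⨁_{n ∈ ℤ^s} I^n t^n`, inside the Laurent polynomial ring
`R[t_1^{±1}, …, t_s^{±1}] = R[ℤ^s]`. -/
def extRees (I : Fin s → Ideal R) : Subalgebra R (AddMonoidAlgebra R (Fin s → ℤ)) where
  carrier := {f | ∀ n, f.coeff n ∈ idealPow I n}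
  mul_mem' {f g} hf hg := coeff_mul_mem (idealPow_mul_le I) f g hf hg
  add_mem' {f g} hf hg := fun n => by
    rw [AddMonoidAlgebra.coeff_add]
    exact Ideal.add_mem _ (hf n) (hg n)
  algebraMap_mem' r := fun n => by
    classical
    rw [AddMonoidAlgebra.coe_algebraMap]
    simp only [Function.comp_apply, AddMonoidAlgebra.coeff_single, Finsupp.single_apply]
    split_ifs with h
    · rw [← h]
      exact (Ideal.eq_top_iff_one _).2 (one_mem_idealPow_zero I) ▸ Submodule.mem_top
    · exact Ideal.zero_mem _

/-- The extended Rees ring `R'(F) = ⨁_{n ∈ ℤ^s} F(n) t^n` of an `I`-filtration `F`, as a module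
over `R'(I)`. -/
def extReesModule {I : Fin s → Ideal R} {F : (Fin s → ℤ) → Ideal R} (hF : IsFiltration I F) :
    Submodule (extRees I) (AddMonoidAlgebra R (Fin s → ℤ)) where
  carrier := {f | ∀ n, f.coeff n ∈ F n}
  zero_mem' := fun n => by simp
  add_mem' {f g} hf hg := fun n => by
    rw [AddMonoidAlgebra.coeff_add]
    exact Ideal.add_mem _ (hf n) (hg n)
  smul_mem' a f hf := coeff_mul_mem
    (fun m n => (Ideal.mul_mono_left (hF.pow_le m)).trans (hF.mul_le n m)) a.1 f a.2 hf

/-- An `I`-admissible filtration: `F(n) = F(n⁺)` for all `n ∈ ℤ^s`, and `R'(F)` is a finite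
`R'(I)`-module. -/
structure IsAdmissible (I : Fin s → Ideal R) (F : (Fin s → ℤ) → Ideal R) : Prop
    extends IsFiltration I F where
  eq_posPart : ∀ n, F n = F (fun i => max (n i) 0)
  finite : Module.Finite (extRees I) (extReesModule toIsFiltration)

/-- The ideal `J = (y_1, …, y_d)`, where `y_j = x_{1j} ⋯ x_{sj}`. -/
def productIdeal {d : ℕ} (x : Fin s → Fin d → R) : Ideal R :=
  Ideal.span (Set.range fun j => ∏ i, x i j)

/-- The array `x_{ij} ∈ I_i` (`1 ≤ i ≤ s`, `1 ≤ j ≤ d`) is a complete reduction of `F`: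
`J F(n) = F(n + e)` for all large `n`, where `e = (1, …, 1)`. Here `d` is meant to be the
dimension of `R`. -/
def IsCompleteReduction {d : ℕ} (I : Fin s → Ideal R) (F : (Fin s → ℤ) → Ideal R)
    (x : Fin s → Fin d → R) : Prop :=
  (∀ i j, x i j ∈ I i) ∧
    ∃ N : Fin s → ℤ, ∀ n, N ≤ n → productIdeal x * F n = F (n + 1)

/-- The set of reduction vectors of `F` with respect to the array `x`: the `r ∈ ℕ^s` such that
`J F(n) = F(n + e)` for all `n ≥ r`. -/
def reductionVectors {d : ℕ} (F : (Fin s → ℤ) → Ideal R) (x : Fin s → Fin d → R) :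
    Set (Fin s → ℕ) :=
  {r | ∀ n : Fin s → ℤ, (∀ i, (r i : ℤ) ≤ n i) → productIdeal x * F n = F (n + 1)}

/-- `k ∈ ℕ` is the complete reduction number of `F` with respect to `x`: `J F(n) = F(n + e)` for
all `n ≥ k e`, and no natural number `t < k` has this property. -/
def IsCompleteReductionNumber {d : ℕ} (F : (Fin s → ℤ) → Ideal R) (x : Fin s → Fin d → R)
    (k : ℕ) : Prop :=
  (∀ n : Fin s → ℤ, (∀ i, (k : ℤ) ≤ n i) → productIdeal x * F n = F (n + 1)) ∧
    ∀ t : ℕ, t < k →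
      ¬ ∀ n : Fin s → ℤ, (∀ i, (t : ℤ) ≤ n i) → productIdeal x * F n = F (n + 1)

/-- A Noetherian local ring is Cohen-Macaulay if it has a regular sequence whose length is the
Krull dimension. (Regular sequences in Mathlib generate a proper ideal, so they lie in the maximal
ideal.) -/
def IsCohenMacaulayLocal (R : Type u) [CommRing R] [IsNoetherianRing R] [IsLocalRing R] : Prop :=
  ∃ rs : List R, RingTheory.Sequence.IsRegular R rs ∧ (rs.length : WithBot ℕ∞) = ringKrullDim R

end MultiFil

/-! The ring element `a = x_1 ⋯ x_s` attached to a complete reduction satisfies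
`a F(n) ⊆ F(n + e)` for every `n`. Let `b` come from a second complete reduction and choose `m`
so large that `a F(m) = F(m + e) = b F(m)`. As `F(m)` is finitely generated and contains a regular
element, the determinant trick shows that `b` is integral over the ideal `(a)`, so that
`b ^ (n + 1) ∈ a (a, b) ^ n` for some `n`. If now `b M = F(k + e)` for `M = F(k)`, then
`a M ⊆ b M`, hence `b ^ (n + 1) M ⊆ a (a, b) ^ n M = a b ^ n M`, and cancelling `b ^ n`, which is
regular because `b` divides a regular element, gives `F(k + e) = b M ⊆ a M`. So the set of
all `k` with `J F(k) = F(k + e)` is the same for all complete reductions. -/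

namespace MultiFil

section DeterminantTrick

variable {R : Type*} [CommRing R]

theorem exists_monic_coeff_mem_pow_eval_eq_zero (M : Type*) [AddCommGroup M] [Module R M]
    [Module.Finite R M] [FaithfulSMul R M] {I : Ideal R} {a : R}
    (h : ∀ m : M, a • m ∈ I • (⊤ : Submodule R M)) :
    ∃ p : Polynomial R, p.Monic ∧ (∀ k, p.coeff k ∈ I ^ (p.natDegree - k)) ∧ p.eval a = 0 := by
  obtain ⟨p, hp, -, hcoeff, hzero⟩ :=
    LinearMap.exists_monic_and_natDegree_eq_and_coeff_mem_pow_and_aeval_eq_zero R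
      (algebraMap R (Module.End R M) a) I (by rintro _ ⟨m, rfl⟩; exact h m)
  refine ⟨p, hp, hcoeff, FaithfulSMul.eq_of_smul_eq_smul (α := M) fun m => ?_⟩
  rw [Polynomial.aeval_algebraMap_apply, Polynomial.coe_aeval_eq_eval] at hzero
  simpa only [Module.algebraMap_end_apply, LinearMap.zero_apply, zero_smul] using
    LinearMap.congr_fun hzero m

theorem pow_succ_mem_mul_sup_pow {I : Ideal R} {a : R} {p : Polynomial R} (hp : p.Monic)
    (hcoeff : ∀ k, p.coeff k ∈ I ^ (p.natDegree - k)) (hzero : p.eval a = 0) :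
    a ^ (p.natDegree + 1) ∈ I * (I ⊔ Ideal.span {a}) ^ p.natDegree := by
  have hexpand : a ^ (p.natDegree + 1) =
      -∑ k ∈ Finset.range p.natDegree, p.coeff k * a ^ (k + 1) := by
    rw [Polynomial.eval_eq_sum_range, Finset.sum_range_succ, hp.coeff_natDegree, one_mul] at hzero
    simp only [pow_succ, ← mul_assoc, ← Finset.sum_mul]
    linear_combination a * hzero
  rw [hexpand]
  refine neg_mem (sum_mem fun k hk => ?_)
  obtain ⟨j, hj⟩ := Nat.exists_eq_add_of_lt (Finset.mem_range.1 hk)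
  have hk_coeff : p.coeff k ∈ I * I ^ j := by
    rw [← pow_succ']
    convert hcoeff k using 2
    lia
  have ha_pow : a ^ (k + 1) ∈ Ideal.span {a} ^ (k + 1) :=
    Ideal.pow_mem_pow (Ideal.mem_span_singleton_self a) _
  refine Ideal.mul_mono_right ?_ (mul_assoc I _ _ ▸ Ideal.mul_mem_mul hk_coeff ha_pow)
  calc I ^ j * Ideal.span {a} ^ (k + 1)
      ≤ (I ⊔ Ideal.span {a}) ^ j * (I ⊔ Ideal.span {a}) ^ (k + 1) :=
        Ideal.mul_mono (Ideal.pow_right_mono le_sup_left _) (Ideal.pow_right_mono le_sup_right _)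
    _ = (I ⊔ Ideal.span {a}) ^ p.natDegree := by rw [← pow_add, hj]; congr 1; lia

theorem exists_pow_succ_mem_mul_sup_pow {I K : Ideal R} {a c : R} (hK : K.FG) (hcK : c ∈ K)
    (hc : c ∈ nonZeroDivisors R) (h : Ideal.span {a} * K ≤ I * K) :
    ∃ n, a ^ (n + 1) ∈ I * (I ⊔ Ideal.span {a}) ^ n := by
  have : Module.Finite R K := Module.Finite.iff_fg.2 hK
  have : FaithfulSMul R K := ⟨fun {r r'} hr =>
    (mul_cancel_right_mem_nonZeroDivisors hc).1 (congrArg Subtype.val (hr ⟨c, hcK⟩))⟩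
  obtain ⟨p, hp, hcoeff, hzero⟩ := exists_monic_coeff_mem_pow_eval_eq_zero K fun k : K =>
    (Submodule.mem_smul_top_iff I K (a • k)).2
      (h (Ideal.mul_mem_mul (Ideal.mem_span_singleton_self a) k.2))
  exact ⟨_, pow_succ_mem_mul_sup_pow hp hcoeff hzero⟩

theorem sup_pow_mul_le {I J M : Ideal R} (h : I * M ≤ J * M) (n : ℕ) :
    (I ⊔ J) ^ n * M ≤ J ^ n * M := by
  induction n with
  | zero => simp only [pow_zero, le_refl]
  | succ n ih =>
    calc (I ⊔ J) ^ (n + 1) * M = (I ⊔ J) ^ n * M * (I ⊔ J) := by ring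
      _ ≤ J ^ n * M * (I ⊔ J) := Ideal.mul_mono_left ih
      _ = J ^ n * (I * M ⊔ J * M) := by rw [← Ideal.sup_mul]; ring
      _ ≤ J ^ n * (J * M) := Ideal.mul_mono_right (sup_le h le_rfl)
      _ = J ^ (n + 1) * M := by ring

theorem span_singleton_mul_le_span_singleton_mul_iff {a : R} (ha : a ∈ nonZeroDivisors R)
    {I J : Ideal R} : Ideal.span {a} * I ≤ Ideal.span {a} * J ↔ I ≤ J := by
  simp_rw [Ideal.span_singleton_mul_le_span_singleton_mul, mul_cancel_left_mem_nonZeroDivisors ha,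
    exists_eq_right', SetLike.le_def]

theorem span_singleton_mul_le_of_pow_succ_mem {I M : Ideal R} {a : R}
    (ha : a ∈ nonZeroDivisors R) (hM : I * M ≤ Ideal.span {a} * M) {n : ℕ}
    (hpow : a ^ (n + 1) ∈ I * (I ⊔ Ideal.span {a}) ^ n) :
    Ideal.span {a} * M ≤ I * M := by
  rw [← span_singleton_mul_le_span_singleton_mul_iff (pow_mem ha n)]
  calc Ideal.span {a ^ n} * (Ideal.span {a} * M) = Ideal.span {a ^ (n + 1)} * M := by
        rw [← mul_assoc, Ideal.span_singleton_mul_span_singleton, pow_succ]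
    _ ≤ I * (I ⊔ Ideal.span {a}) ^ n * M :=
        Ideal.mul_mono_left ((Ideal.span_singleton_le_iff_mem _).2 hpow)
    _ = I * ((I ⊔ Ideal.span {a}) ^ n * M) := mul_assoc _ _ _
    _ ≤ I * (Ideal.span {a} ^ n * M) := Ideal.mul_mono_right (sup_pow_mul_le hM n)
    _ = Ideal.span {a ^ n} * (I * M) := by rw [Ideal.span_singleton_pow]; ring

end DeterminantTrick

theorem isLeast_image_sup_of_isUpperSet {ι α : Type*} [Fintype ι] [SemilatticeSup α] [OrderBot α]
    {V : Set (ι → α)} (hV : IsUpperSet V) {k : α} (hk : IsLeast {k | (fun _ => k) ∈ V} k) :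
    IsLeast (Finset.univ.sup '' V) k := by
  have lower : k ∈ lowerBounds (Finset.univ.sup '' V) := by
    rintro _ ⟨r, hr, rfl⟩
    exact hk.2 (hV (fun i => Finset.le_sup (Finset.mem_univ i)) hr)
  exact ⟨⟨_, hk.1, (Finset.sup_le fun _ _ => le_rfl).antisymm (lower ⟨_, hk.1, rfl⟩)⟩, lower⟩

theorem exists_mem_maximalIdeal_mem_nonZeroDivisors {R : Type*} [CommRing R] [IsNoetherianRing R]
    [IsLocalRing R] (hCM : IsCohenMacaulayLocal R) (hdim : 0 < ringKrullDim R) :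
    ∃ z ∈ IsLocalRing.maximalIdeal R, z ∈ nonZeroDivisors R := by
  obtain ⟨rs, hreg, hlen⟩ := hCM
  obtain ⟨z, zs, rfl⟩ : ∃ z zs, rs = z :: zs := List.exists_cons_of_length_pos <| by
    rw [← hlen] at hdim
    exact_mod_cast hdim
  have hproper : Ideal.ofList (z :: zs) ≠ ⊤ := fun htop =>
    hreg.top_ne_smul (by rw [htop, Submodule.top_smul])
  refine ⟨z, IsLocalRing.le_maximalIdeal hproper (Ideal.subset_span List.mem_cons_self), ?_⟩
  have hz := ((RingTheory.Sequence.isRegular_cons_iff R z zs).1 hreg).1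
  exact mem_nonZeroDivisors_iff_right.2 fun w hw =>
    hz.right_eq_zero_of_smul (by rwa [smul_eq_mul, mul_comm])

theorem exists_mem_nonZeroDivisors_of_maximalIdeal_le_radical {R : Type*} [CommRing R]
    [IsNoetherianRing R] [IsLocalRing R] (hCM : IsCohenMacaulayLocal R)
    (hdim : 0 < ringKrullDim R) {I : Ideal R} (hI : IsLocalRing.maximalIdeal R ≤ I.radical) :
    ∃ z ∈ I, z ∈ nonZeroDivisors R := by
  obtain ⟨z, hzm, hz⟩ := exists_mem_maximalIdeal_mem_nonZeroDivisors hCM hdim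
  obtain ⟨j, hj⟩ := hI hzm
  exact ⟨z ^ j, hj, pow_mem hz j⟩

section CompleteReduction

variable {R : Type*} [CommRing R] {s d : ℕ} {I : Fin s → Ideal R} {F : (Fin s → ℤ) → Ideal R}

theorem exists_mem_idealPow_mem_nonZeroDivisors (hI : ∀ i, ∃ z ∈ I i, z ∈ nonZeroDivisors R)
    (n : Fin s → ℤ) : ∃ c ∈ idealPow I n, c ∈ nonZeroDivisors R := by
  choose z hzI hz using hI
  exact ⟨∏ i, z i ^ (n i).toNat,
    Ideal.prod_mem_prod fun i _ => Ideal.pow_mem_pow (hzI i) _,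
    prod_mem fun i _ => pow_mem (hz i) _⟩

theorem productIdeal_eq_span_singleton (x : Fin s → Fin 1 → R) :
    productIdeal x = Ideal.span {∏ i, x i 0} := by
  rw [productIdeal, Set.range_unique, Fin.default_eq_zero]

theorem productIdeal_le_idealPow_one {x : Fin s → Fin d → R} (hx : ∀ i j, x i j ∈ I i) :
    productIdeal x ≤ idealPow I 1 := by
  refine Ideal.span_le.2 ?_
  rintro _ ⟨j, rfl⟩
  refine Ideal.prod_mem_prod fun i _ => ?_
  simpa only [Pi.one_apply, Int.toNat_one, pow_one] using hx i j

theorem productIdeal_mul_le (hF : IsFiltration I F) {x : Fin s → Fin d → R}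
    (hx : ∀ i j, x i j ∈ I i) (n : Fin s → ℤ) : productIdeal x * F n ≤ F (n + 1) :=
  calc productIdeal x * F n ≤ F 1 * F n :=
        Ideal.mul_mono_left ((productIdeal_le_idealPow_one hx).trans (hF.pow_le 1))
    _ = F n * F 1 := mul_comm _ _
    _ ≤ F (n + 1) := hF.mul_le 1 n

theorem IsCompleteReduction.prod_mem_nonZeroDivisors (hF : IsFiltration I F)
    (hI : ∀ i, ∃ z ∈ I i, z ∈ nonZeroDivisors R) {x : Fin s → Fin 1 → R}
    (hx : IsCompleteReduction I F x) : ∏ i, x i 0 ∈ nonZeroDivisors R := by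
  obtain ⟨-, N, hN⟩ := hx
  obtain ⟨c, hcI, hc⟩ := exists_mem_idealPow_mem_nonZeroDivisors hI (N + 1)
  have hcF := hF.pow_le _ hcI
  rw [← hN N le_rfl, productIdeal_eq_span_singleton] at hcF
  obtain ⟨r, -, rfl⟩ := Ideal.mem_span_singleton_mul.1 hcF
  exact (mul_mem_nonZeroDivisors.1 hc).1

theorem IsCompleteReduction.mul_eq_of_mul_eq (hF : IsFiltration I F) (hFG : ∀ n, (F n).FG)
    (hI : ∀ i, ∃ z ∈ I i, z ∈ nonZeroDivisors R) {x y : Fin s → Fin 1 → R}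
    (hx : IsCompleteReduction I F x) (hy : IsCompleteReduction I F y) {n : Fin s → ℤ}
    (hn : productIdeal x * F n = F (n + 1)) : productIdeal y * F n = F (n + 1) := by
  have hreg := hx.prod_mem_nonZeroDivisors hF hI
  obtain ⟨-, N, hN⟩ := hx
  obtain ⟨hyI, N', hN'⟩ := hy
  obtain ⟨c, hcI, hc⟩ := exists_mem_idealPow_mem_nonZeroDivisors hI (N ⊔ N')
  have hlarge : productIdeal x * F (N ⊔ N') ≤ productIdeal y * F (N ⊔ N') :=
    ((hN _ le_sup_left).trans (hN' _ le_sup_right).symm).le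
  have hle := productIdeal_mul_le hF hyI n
  refine hle.antisymm ?_
  rw [← hn] at hle ⊢
  rw [productIdeal_eq_span_singleton x] at hlarge hle ⊢
  obtain ⟨k, hk⟩ := exists_pow_succ_mem_mul_sup_pow (hFG _) (hF.pow_le _ hcI) hc hlarge
  exact span_singleton_mul_le_of_pow_succ_mem hreg hle hk

theorem reductionVectors_eq_of_isCompleteReduction (hF : IsFiltration I F)
    (hFG : ∀ n, (F n).FG) (hI : ∀ i, ∃ z ∈ I i, z ∈ nonZeroDivisors R) {x y : Fin s → Fin 1 → R}
    (hx : IsCompleteReduction I F x) (hy : IsCompleteReduction I F y) :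
    reductionVectors F x = reductionVectors F y :=
  Set.ext fun _ => forall₂_congr fun _ _ =>
    ⟨hx.mul_eq_of_mul_eq hF hFG hI hy, hy.mul_eq_of_mul_eq hF hFG hI hx⟩

theorem isUpperSet_reductionVectors (x : Fin s → Fin d → R) :
    IsUpperSet (reductionVectors F x) := fun _ _ hle hr n hn =>
  hr n fun i => (Int.ofNat_le.2 (hle i)).trans (hn i)

theorem IsCompleteReduction.exists_const_mem_reductionVectors {x : Fin s → Fin d → R}
    (hx : IsCompleteReduction I F x) : ∃ k : ℕ, (fun _ => k) ∈ reductionVectors F x := by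
  obtain ⟨-, N, hN⟩ := hx
  refine ⟨Finset.univ.sup fun i => (N i).toNat, fun n hn => hN n fun i => ?_⟩
  calc N i ≤ (N i).toNat := Int.self_le_toNat _
    _ ≤ (Finset.univ.sup fun i => (N i).toNat : ℕ) :=
        Int.ofNat_le.2 (Finset.le_sup (f := fun i => (N i).toNat) (Finset.mem_univ i))
    _ ≤ n i := hn i

theorem isCompleteReductionNumber_iff_isLeast {x : Fin s → Fin d → R} {k : ℕ} :
    IsCompleteReductionNumber F x k ↔
      IsLeast {k : ℕ | (fun _ => k) ∈ reductionVectors F x} k :=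
  and_congr_right fun _ => forall_congr' fun _ =>
    imp_not_comm.trans (imp_congr_right fun _ => not_lt)

end CompleteReduction

end MultiFil

open MultiFil in
theorem theorem5p4_general {R : Type*} [CommRing R] {s : ℕ} {I : Fin s → Ideal R}
    (hI : ∀ i, ∃ z ∈ I i, z ∈ nonZeroDivisors R) {F : (Fin s → ℤ) → Ideal R}
    (hF : IsFiltration I F) (hFG : ∀ n, (F n).FG) :
    ∃ k : ℕ, ∀ x : Fin s → Fin 1 → R, IsCompleteReduction I F x →
      IsCompleteReductionNumber F x k ∧
      IsLeast ((fun r : Fin s → ℕ => Finset.univ.sup r) '' reductionVectors F x) k := by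
  by_cases hex : ∃ x : Fin s → Fin 1 → R, IsCompleteReduction I F x
  · obtain ⟨x₀, hx₀⟩ := hex
    obtain ⟨k, hk⟩ : ∃ k, IsLeast {k : ℕ | (fun _ => k) ∈ reductionVectors F x₀} k :=
      ⟨_, isLeast_csInf hx₀.exists_const_mem_reductionVectors⟩
    refine ⟨k, fun x hx => ?_⟩
    rw [reductionVectors_eq_of_isCompleteReduction hF hFG hI hx₀ hx] at hk
    exact ⟨isCompleteReductionNumber_iff_isLeast.2 hk,
      isLeast_image_sup_of_isUpperSet (isUpperSet_reductionVectors x) hk⟩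
  · exact ⟨0, fun x hx => absurd ⟨x, hx⟩ hex⟩

/-- The ideals `I i` are primary to the maximal ideal (equivalently, their radical is the maximal
ideal). In dimension one a complete reduction consists of one element of each `I i`. -/
theorem theorem5p4 {R : Type*} [CommRing R] [IsNoetherianRing R] [IsLocalRing R]
    (hCM : MultiFil.IsCohenMacaulayLocal R) (hdim : ringKrullDim R = 1)
    (s : ℕ) (hs : 1 ≤ s) (I : Fin s → Ideal R)
    (hI : ∀ i, (I i).radical = IsLocalRing.maximalIdeal R)
    (F : (Fin s → ℤ) → Ideal R) (hF : MultiFil.IsAdmissible I F) :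
    ∃ k : ℕ, ∀ x : Fin s → Fin 1 → R, MultiFil.IsCompleteReduction I F x →
      MultiFil.IsCompleteReductionNumber F x k ∧
      IsLeast ((fun r : Fin s → ℕ => Finset.univ.sup r) '' MultiFil.reductionVectors F x) k := by
  have hreg (i : Fin s) : ∃ z ∈ I i, z ∈ nonZeroDivisors R :=
    MultiFil.exists_mem_nonZeroDivisors_of_maximalIdeal_le_radical hCM (hdim ▸ zero_lt_one)
      (hI i).ge
  exact theorem5p4_general hreg hF.toIsFiltration fun n => (F n).fg_of_isNoetherianRing
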